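/- All vector spaces are over $\mathbb{R}$. A diffeological vector space is a vector space with a diffeology for which addition $V\times V\to V$ and scalar multiplication $\mathbb{R}\times V\to V$ are smooth; subspaces, products and quotients carry the sub-, product and quotient diffeologies. A linear subduction is a smooth surjective linear map whose target carries the quotient diffeology, i.e. every plot of the target locally lifts to a plot of the source; a linear induction is an injective linear map whose source carries the diffeology pulled back from the target. A short exact sequence of diffeological vector spaces is a short exact sequence of vector spaces $0\to A\xrightarrow{i}V\xrightarrow{p}B\to 0$ with $i$ a linear induction and $p$ a linear subduction. A complex $A\xrightarrow{f}V\xrightarrow{g}B$ of smooth linear maps is exact at $V$ if the induced sequence $0\to A/\ker f\to V\to \operatorname{im} g\to 0$ is a short exact sequence of diffeological vector spaces. A diffeological vector space $V$ is projective if for every linear subduction $f:W_1\to W_2$ of diffeological vector spaces and every smooth linear map $g:V\to W_2$ there is a smooth linear map $h:V\to W_1$ with $g=f\circ h$. A diffeological projective resolution of $V$ is a complex $\cdots\to P_2\to P_1\to P_0\to V\to 0$ of diffeological vector spaces and smooth linear maps that is exact at every spot, with all $P_n$ projective. Let $L^\infty(V,W)$ be the diffeological vector space of smooth linear maps $V\to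 W$ with the functional diffeology, and $$\operatorname{Ext}^n(V,W):=H^n\bigl(0\to L^\infty(P_0,W)\to L^\infty(P_1,W)\to L^\infty(P_2,W)\to\cdots\bigr)$$ for a diffeological projective resolution $P_\bullet\to V$. Corollary 7.8. A diffeological vector space $V$ is projective if and only if $\operatorname{Ext}^1(V,W)=0$ for every diffeological vector space $W$. This holds both when $\operatorname{Ext}^1(V,W)=0$ is read as vanishing for every diffeological projective resolution of $V$, and when it is read as vanishing for some diffeological projective resolution of $V$ (which may depend on $W$). -/

import Mathlib

open Diffeology Topology
open scoped ContDiff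

universe u v w

/-! ### Product, subset and quotient diffeologies, inductions and subductions -/

/-- The product diffeology: a map into `X × Y` is a plot iff both of its components are plots. -/
instance Prod.instDiffeologicalSpace {X : Type u} {Y : Type v}
    [DiffeologicalSpace X] [DiffeologicalSpace Y] : DiffeologicalSpace (X × Y) where
  plots n := {p | IsPlot (fun t => (p t).1) ∧ IsPlot (fun t => (p t).2)}
  constant_plots _ := ⟨isPlot_const, isPlot_const⟩
  plot_reparam hp hf := ⟨isPlot_reparam hp.1 hf, isPlot_reparam hp.2 hf⟩
  locality hp := by
    refine ⟨DiffeologicalSpace.locality fun x => ?_, DiffeologicalSpace.locality fun x => ?_⟩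
    · obtain ⟨s, hs, hxs, h⟩ := hp x
      exact ⟨s, hs, hxs, fun h1 h2 => (h h1 h2).1⟩
    · obtain ⟨s, hs, hxs, h⟩ := hp x
      exact ⟨s, hs, hxs, fun h1 h2 => (h h1 h2).2⟩

/-- The sub-diffeology: a map into a subset is a plot iff it is a plot of the ambient space. -/
instance Subtype.instDiffeologicalSpace {X : Type u} [DiffeologicalSpace X] (s : X → Prop) :
    DiffeologicalSpace (Subtype s) where
  plots n := {p | IsPlot (fun t => (p t : X))}
  constant_plots _ := isPlot_const
  plot_reparam hp hf := isPlot_reparam hp hf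
  locality hp := DiffeologicalSpace.locality hp

/-- A smooth self-map of Euclidean space that is the identity near `x` and takes its values in
a given neighbourhood of `x`. -/
theorem exists_contDiff_eventuallyEq_id {n : ℕ} {x : EuclideanSpace ℝ (Fin n)}
    {s : Set (EuclideanSpace ℝ (Fin n))} (hs : IsOpen s) (hx : x ∈ s) :
    ∃ φ : EuclideanSpace ℝ (Fin n) → EuclideanSpace ℝ (Fin n),
      ContDiff ℝ ∞ φ ∧ (∀ y, φ y ∈ s) ∧ ∀ᶠ y in 𝓝 x, φ y = y := by
  obtain ⟨ε, hε, hball⟩ := Metric.isOpen_iff.mp hs x hx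
  let c : ContDiffBump x := ⟨ε / 2, ε, by positivity, by linarith⟩
  refine ⟨fun y => x + c y • (y - x), ?_, fun y => hball ?_, ?_⟩
  · exact contDiff_const.add (c.contDiff.smul (contDiff_id.sub contDiff_const))
  · rw [mem_ball_iff_norm, add_sub_cancel_left]
    by_cases hy : c y = 0
    · simpa [hy] using hε
    · have hy' : y ∈ Metric.ball x ε := by
        rw [← c.support_eq]; exact hy
      rw [mem_ball_iff_norm] at hy'
      rw [norm_smul, Real.norm_of_nonneg c.nonneg]
      calc c y * ‖y - x‖ ≤ 1 * ‖y - x‖ := by gcongr; exact c.le_one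
        _ < ε := by rwa [one_mul]
  · filter_upwards [c.eventuallyEq_one] with y hy
    simp [hy]

/-- The quotient diffeology on a quotient vector space: the plots are the maps that locally lift
along the projection to plots of the total space. -/
instance Submodule.Quotient.instDiffeologicalSpace {V : Type u} [AddCommGroup V] [Module ℝ V]
    [DiffeologicalSpace V] (S : Submodule ℝ V) : DiffeologicalSpace (V ⧸ S) where
  plots n := {q | ∀ x, ∃ p : EuclideanSpace ℝ (Fin n) → V,
    IsPlot p ∧ ∀ᶠ y in 𝓝 x, S.mkQ (p y) = q y}
  constant_plots q _ := by
    obtain ⟨v, rfl⟩ := S.mkQ_surjective q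
    exact ⟨fun _ => v, isPlot_const, by simp⟩
  plot_reparam {n m q f} hq hf x := by
    obtain ⟨p, hp, h⟩ := hq (f x)
    exact ⟨p ∘ f, isPlot_reparam hp hf, hf.continuous.continuousAt.eventually h⟩
  locality {n q} hq x := by
    obtain ⟨s, hs, hxs, h⟩ := hq x
    obtain ⟨φ, hφ, hφs, hφx⟩ := exists_contDiff_eventuallyEq_id hs hxs
    obtain ⟨p, hp, hpq⟩ := h hφs hφ x
    refine ⟨p, hp, ?_⟩
    filter_upwards [hpq, hφx] with y h1 h2
    rw [h1, Function.comp_apply, h2]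

/-- An induction: an injective map `f : X → Y` such that `X` carries the diffeology pulled back
from `Y`, that is, `X` is identified with a subset of `Y` with the sub-diffeology. -/
def IsInduction {X : Type u} {Y : Type v} [DiffeologicalSpace X] [DiffeologicalSpace Y]
    (f : X → Y) : Prop :=
  Function.Injective f ∧
    ∀ (n : ℕ) (p : EuclideanSpace ℝ (Fin n) → X), IsPlot p ↔ IsPlot (f ∘ p)

/-- A subduction: a smooth surjection `f : X → Y` such that `Y` carries the quotient diffeology,
that is, every plot of `Y` locally lifts along `f` to a plot of `X`. (A plot defined near `x` agrees
near `x` with a plot defined everywhere, so the lifts may be taken to be globally defined.) -/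
def IsSubduction {X : Type u} {Y : Type v} [DiffeologicalSpace X] [DiffeologicalSpace Y]
    (f : X → Y) : Prop :=
  Function.Surjective f ∧ DSmooth f ∧
    ∀ (n : ℕ) (q : EuclideanSpace ℝ (Fin n) → Y), IsPlot q → ∀ x,
      ∃ p : EuclideanSpace ℝ (Fin n) → X, IsPlot p ∧ ∀ᶠ y in 𝓝 x, f (p y) = q y

/-! ### Diffeological vector spaces -/

/-- A diffeological vector space: a real vector space with a diffeology for which addition and
scalar multiplication are smooth. -/
class DiffeologicalVectorSpace (V : Type u) [AddCommGroup V] [Module ℝ V]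
    [DiffeologicalSpace V] : Prop where
  dSmooth_add : DSmooth (fun x : V × V => x.1 + x.2)
  dSmooth_smul : DSmooth (fun x : ℝ × V => x.1 • x.2)

namespace DiffeologicalVectorSpace

section Instances

variable {V : Type u} [AddCommGroup V] [Module ℝ V] [DiffeologicalSpace V]
  [DiffeologicalVectorSpace V]

theorem isPlot_add {n : ℕ} {p q : EuclideanSpace ℝ (Fin n) → V} (hp : IsPlot p) (hq : IsPlot q) :
    IsPlot (fun t => p t + q t) :=
  dSmooth_add n (fun t => (p t, q t)) ⟨hp, hq⟩

theorem isPlot_smul {n : ℕ} {c : EuclideanSpace ℝ (Fin n) → ℝ}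
    {p : EuclideanSpace ℝ (Fin n) → V} (hc : IsPlot c) (hp : IsPlot p) :
    IsPlot (fun t => c t • p t) :=
  dSmooth_smul n (fun t => (c t, p t)) ⟨hc, hp⟩

/-- A linear subspace is a diffeological vector space. -/
instance instSubmodule (S : Submodule ℝ V) : DiffeologicalVectorSpace S where
  dSmooth_add _ _ hp := isPlot_add (V := V) hp.1 hp.2
  dSmooth_smul _ _ hp := isPlot_smul (V := V) hp.1 hp.2

/-- A quotient vector space is a diffeological vector space. -/
instance instQuotient (S : Submodule ℝ V) : DiffeologicalVectorSpace (V ⧸ S) where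
  dSmooth_add n p hp x := by
    obtain ⟨a, ha, ha'⟩ := hp.1 x
    obtain ⟨b, hb, hb'⟩ := hp.2 x
    refine ⟨_, isPlot_add ha hb, ?_⟩
    filter_upwards [ha', hb'] with y h1 h2
    rw [map_add, h1, h2, Function.comp_apply]
  dSmooth_smul n p hp x := by
    obtain ⟨b, hb, hb'⟩ := hp.2 x
    refine ⟨_, isPlot_smul hp.1 hb, ?_⟩
    filter_upwards [hb'] with y h2
    rw [map_smul, h2, Function.comp_apply]

end Instances

end DiffeologicalVectorSpace

open DiffeologicalVectorSpace

/-- The set `L^∞(V, W)` of smooth linear maps. -/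
@[ext]
structure SmoothLinearMap (V : Type u) [AddCommGroup V] [Module ℝ V] [DiffeologicalSpace V]
    (W : Type v) [AddCommGroup W] [Module ℝ W] [DiffeologicalSpace W] where
  toLinearMap : V →ₗ[ℝ] W
  smooth : DSmooth (fun x : V => toLinearMap x)

namespace SmoothLinearMap

section Structure

variable {V : Type u} [AddCommGroup V] [Module ℝ V] [DiffeologicalSpace V]
  {W : Type v} [AddCommGroup W] [Module ℝ W] [DiffeologicalSpace W]

theorem toLinearMap_injective :
    Function.Injective (toLinearMap : SmoothLinearMap V W → V →ₗ[ℝ] W) :=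
  fun _ _ h => SmoothLinearMap.ext h

variable [DiffeologicalVectorSpace W]

instance : Zero (SmoothLinearMap V W) := ⟨⟨0, dSmooth_const⟩⟩

instance : Add (SmoothLinearMap V W) :=
  ⟨fun f g => ⟨f.1 + g.1, fun n p hp => isPlot_add (f.2 n p hp) (g.2 n p hp)⟩⟩

instance : SMul ℝ (SmoothLinearMap V W) :=
  ⟨fun c f => ⟨c • f.1, fun n p hp => isPlot_smul isPlot_const (f.2 n p hp)⟩⟩

instance : Neg (SmoothLinearMap V W) :=
  ⟨fun f => ⟨-f.1, by
    have h : DSmooth (fun x : V => (-1 : ℝ) • f.1 x) := ((-1 : ℝ) • f).2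
    simpa using h⟩⟩

instance : Sub (SmoothLinearMap V W) :=
  ⟨fun f g => ⟨f.1 - g.1, by
    have h : DSmooth (fun x : V => f.1 x + -g.1 x) := (f + -g).2
    simpa [sub_eq_add_neg] using h⟩⟩

instance : SMul ℕ (SmoothLinearMap V W) :=
  ⟨fun c f => ⟨c • f.1, by
    have h : DSmooth (fun x : V => (c : ℝ) • f.1 x) := ((c : ℝ) • f).2
    simpa [Nat.cast_smul_eq_nsmul] using h⟩⟩

instance : SMul ℤ (SmoothLinearMap V W) :=
  ⟨fun c f => ⟨c • f.1, by
    have h : DSmooth (fun x : V => (c : ℝ) • f.1 x) := ((c : ℝ) • f).2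
    simpa [Int.cast_smul_eq_zsmul] using h⟩⟩

/-- Smooth linear maps form a vector space under the pointwise operations. -/
instance : AddCommGroup (SmoothLinearMap V W) :=
  toLinearMap_injective.addCommGroup _ rfl (fun _ _ => rfl) (fun _ => rfl) (fun _ _ => rfl)
    (fun _ _ => rfl) (fun _ _ => rfl)

instance : Module ℝ (SmoothLinearMap V W) :=
  toLinearMap_injective.module ℝ ⟨⟨toLinearMap, rfl⟩, fun _ _ => rfl⟩ (fun _ _ => rfl)

/-- The functional diffeology on `L^∞(V, W)`: a family `t ↦ p t` of smooth linear maps is a plot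
iff `(t, v) ↦ p t v` is smooth. -/
instance : DiffeologicalSpace (SmoothLinearMap V W) where
  plots n := {p | DSmooth (fun x : EuclideanSpace ℝ (Fin n) × V => (p x.1).1 x.2)}
  constant_plots f n p hp := f.2 n _ hp.2
  plot_reparam {n m p f} hp hf k q hq :=
    hp k (fun t => (f (q t).1, (q t).2)) ⟨hf.dSmooth k _ hq.1, hq.2⟩
  locality {n p} hp k q hq := by
    refine DiffeologicalSpace.locality fun x => ?_
    obtain ⟨s, hs, hxs, h⟩ := hp (q x).1
    have hq1 : ContDiff ℝ ∞ (fun t => (q t).1) := IsPlot.contDiff hq.1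
    refine ⟨(fun t => (q t).1) ⁻¹' s, hs.preimage hq1.continuous, hxs, fun {m f} hfs hf => ?_⟩
    exact h (f := fun t => (q (f t)).1) hfs (hq1.comp hf) m (fun t => (t, (q (f t)).2))
      ⟨isPlot_id, isPlot_reparam hq.2 hf⟩

/-- `L^∞(V, W)` is a diffeological vector space. -/
instance : DiffeologicalVectorSpace (SmoothLinearMap V W) where
  dSmooth_add _ _ hp k q hq := isPlot_add (hp.1 k q hq) (hp.2 k q hq)
  dSmooth_smul _ _ hp k q hq := isPlot_smul (IsPlot.dSmooth hp.1 k _ hq.1) (hp.2 k q hq)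

end Structure

/-- The map `f^* : L^∞(B, W) → L^∞(A, W)`, `g ↦ g ∘ f`, induced by a smooth linear map
`f : A → B`. -/
def precomp {A : Type u} [AddCommGroup A] [Module ℝ A] [DiffeologicalSpace A]
    {B : Type w} [AddCommGroup B] [Module ℝ B] [DiffeologicalSpace B]
    (f : SmoothLinearMap A B)
    (W : Type v) [AddCommGroup W] [Module ℝ W] [DiffeologicalSpace W]
    [DiffeologicalVectorSpace W] :
    SmoothLinearMap B W →ₗ[ℝ] SmoothLinearMap A W where
  toFun g := ⟨g.1 ∘ₗ f.1, g.2.comp f.2⟩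
  map_add' _ _ := rfl
  map_smul' _ _ := rfl

end SmoothLinearMap

/-! ### Exactness, projectivity, resolutions and Ext -/

/-- `0 → A → V → B → 0` is a short exact sequence of diffeological vector spaces: it is a short
exact sequence of vector spaces, `i` is an induction and `p` is a subduction. -/
structure IsDiffeologicalShortExact
    {A : Type u} [AddCommGroup A] [Module ℝ A] [DiffeologicalSpace A]
    {V : Type v} [AddCommGroup V] [Module ℝ V] [DiffeologicalSpace V]
    {B : Type w} [AddCommGroup B] [Module ℝ B] [DiffeologicalSpace B]
    (i : A →ₗ[ℝ] V) (p : V →ₗ[ℝ] B) : Prop where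
  injective : Function.Injective i
  exact : Function.Exact i p
  surjective : Function.Surjective p
  isInduction : IsInduction i
  isSubduction : IsSubduction p

/-- Exactness of `A → V → B` at `V`: the induced sequence `0 → A / ker f → V → im g → 0`, with the
quotient diffeology on `A / ker f` and the sub-diffeology on `im g ⊆ B`, is a short exact sequence
of diffeological vector spaces. -/
def IsDiffeologicalExactAt
    {A : Type u} [AddCommGroup A] [Module ℝ A] [DiffeologicalSpace A]
    {V : Type v} [AddCommGroup V] [Module ℝ V] [DiffeologicalSpace V]
    {B : Type w} [AddCommGroup B] [Module ℝ B] [DiffeologicalSpace B]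
    (f : A →ₗ[ℝ] V) (g : V →ₗ[ℝ] B) : Prop :=
  IsDiffeologicalShortExact ((LinearMap.ker f).liftQ f le_rfl) g.rangeRestrict

/-- A diffeological vector space `V` is projective if every smooth linear map `g : V → W₂` lifts,
as a smooth linear map, along every linear subduction `f : W₁ → W₂` of diffeological vector
spaces. -/
def IsProjectiveDVS (V : Type u) [AddCommGroup V] [Module ℝ V] [DiffeologicalSpace V] : Prop :=
  ∀ (W₁ : Type u) [AddCommGroup W₁] [Module ℝ W₁] [DiffeologicalSpace W₁]
    [DiffeologicalVectorSpace W₁]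
    (W₂ : Type u) [AddCommGroup W₂] [Module ℝ W₂] [DiffeologicalSpace W₂]
    [DiffeologicalVectorSpace W₂]
    (f : W₁ →ₗ[ℝ] W₂) (_ : IsSubduction f) (g : SmoothLinearMap V W₂),
    ∃ h : SmoothLinearMap V W₁, ∀ v : V, g.1 v = f (h.1 v)

/-- A diffeological projective resolution `⋯ → X 2 → X 1 → X 0 → V → 0` of `V`: an exact
diffeological chain complex with all `X n` projective. Exactness at `V` means that `X 0 / ker ε → V`
is an isomorphism of diffeological vector spaces, that is, that `ε` is a subduction. -/
structure DiffeologicalProjectiveResolution (V : Type u) [AddCommGroup V] [Module ℝ V]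
    [DiffeologicalSpace V] [DiffeologicalVectorSpace V] where
  X : ℕ → Type u
  instAddCommGroup : ∀ n, AddCommGroup (X n)
  instModule : ∀ n, Module ℝ (X n)
  instDiffeologicalSpace : ∀ n, DiffeologicalSpace (X n)
  instDVS : ∀ n, DiffeologicalVectorSpace (X n)
  projective : ∀ n, IsProjectiveDVS (X n)
  d : ∀ n, SmoothLinearMap (X (n + 1)) (X n)
  ε : SmoothLinearMap (X 0) V
  exact_augmentation : IsSubduction ε.1
  exact_zero : IsDiffeologicalExactAt (d 0).1 ε.1
  exact_succ : ∀ n, IsDiffeologicalExactAt (d (n + 1)).1 (d n).1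

namespace DiffeologicalProjectiveResolution

attribute [instance] instAddCommGroup instModule instDiffeologicalSpace instDVS

variable {V : Type u} [AddCommGroup V] [Module ℝ V] [DiffeologicalSpace V]
  [DiffeologicalVectorSpace V] (P : DiffeologicalProjectiveResolution V)
  (W : Type v) [AddCommGroup W] [Module ℝ W] [DiffeologicalSpace W] [DiffeologicalVectorSpace W]

/-- The `n`-cocycles of the cochain complex
`0 → L^∞(X 0, W) → L^∞(X 1, W) → L^∞(X 2, W) → ⋯`. -/
def cocycles (n : ℕ) : Submodule ℝ (SmoothLinearMap (P.X n) W) :=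
  LinearMap.ker (SmoothLinearMap.precomp (P.d n) W)

/-- The `n`-coboundaries of the cochain complex
`0 → L^∞(X 0, W) → L^∞(X 1, W) → L^∞(X 2, W) → ⋯`. -/
def coboundaries : (n : ℕ) → Submodule ℝ (SmoothLinearMap (P.X n) W)
  | 0 => ⊥
  | n + 1 => LinearMap.range (SmoothLinearMap.precomp (P.d n) W)

/-- `Ext^n(V, W) = H^n(L^∞(P, W))`, computed from the projective resolution `P` of `V`. It carries
the quotient diffeology of the sub-diffeology of the functional diffeology. -/
abbrev Ext (n : ℕ) : Type (max u v) :=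
  P.cocycles W n ⧸ (P.coboundaries W n).submoduleOf (P.cocycles W n)

end DiffeologicalProjectiveResolution

/-! ### Local nature of plots and global lifts along linear subductions -/

/-! If `V` is projective, the augmentation `ε` has a smooth linear section `s`, and `r = id - s ∘ ε`
maps `X 0` into `ker ε = range (d 0)`, fixing that range pointwise. A 1-cocycle kills `range (d 1) =
ker (d 0)`, so it factors through the subduction `X 1 → range (d 0)` as a map `k`, and `k ∘ r` is a
cochain whose coboundary is the cocycle. Conversely, given a subduction `f` and a map `g` out of
`V`, projectivity of `X 0` lifts `g ∘ ε` to some `φ`. Then `φ ∘ d 0` is a 1-cocycle with values in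
`ker f`. Writing it as `b ∘ d 0`, the difference `φ - b` kills `ker ε` and descends to the required
lift of `g`. Both descents are `IsSubduction.exists_factor`. Resolutions must also exist, lest
vanishing for all of them be vacuous. They are built from free spaces on Euclidean domains, whose
projectivity rests on the global lifting of plots, `IsSubduction.exists_isPlot_lift`. -/

theorem isPlot_of_eventuallyEq {X : Type*} [DiffeologicalSpace X] {n : ℕ}
    {q : EuclideanSpace ℝ (Fin n) → X}
    (h : ∀ x, ∃ p : EuclideanSpace ℝ (Fin n) → X, IsPlot p ∧ ∀ᶠ y in 𝓝 x, p y = q y) :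
    IsPlot q := by
  refine DiffeologicalSpace.locality fun x => ?_
  obtain ⟨p, hp, hpq⟩ := h x
  obtain ⟨s, hs, hso, hxs⟩ := eventually_nhds_iff.mp hpq
  refine ⟨s, hso, hxs, fun {m f} hf hfs => ?_⟩
  have : q ∘ f = p ∘ f := funext fun t => (hs _ (hf t)).symm
  rw [this]
  exact isPlot_reparam hp hfs

theorem isPlot_sum {V : Type*} [AddCommGroup V] [Module ℝ V] [DiffeologicalSpace V]
    [DiffeologicalVectorSpace V] {n : ℕ} {ι : Type*} (s : Finset ι)
    {p : ι → EuclideanSpace ℝ (Fin n) → V} (hp : ∀ i, IsPlot (p i)) :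
    IsPlot (fun t => ∑ i ∈ s, p i t) := by
  classical
  induction s using Finset.induction_on with
  | empty => simpa using isPlot_const
  | insert a s ha ih => simpa [Finset.sum_insert ha] using isPlot_add (hp a) ih

/-- A plot of the target of a linear subduction lifts globally: local lifts are glued by a smooth
partition of unity. -/
theorem IsSubduction.exists_isPlot_lift {V : Type*} [AddCommGroup V] [Module ℝ V]
    [DiffeologicalSpace V] [DiffeologicalVectorSpace V] {W : Type*} [AddCommGroup W] [Module ℝ W]
    [DiffeologicalSpace W] {f : V →ₗ[ℝ] W} (hf : IsSubduction f) {n : ℕ}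
    {q : EuclideanSpace ℝ (Fin n) → W} (hq : IsPlot q) :
    ∃ p : EuclideanSpace ℝ (Fin n) → V, IsPlot p ∧ ∀ y, f (p y) = q y := by
  choose p hp hpq using hf.2.2 n q hq
  obtain ⟨ρ, hρ⟩ := SmoothPartitionOfUnity.exists_isSubordinate
    (modelWithCornersSelf ℝ (EuclideanSpace ℝ (Fin n))) isClosed_univ
    (fun x => interior {y | f (p x y) = q y}) (fun _ => isOpen_interior)
    (fun x _ => Set.mem_iUnion_of_mem x (mem_interior_iff_mem_nhds.mpr (hpq x)))
  -- The index set `ρ.finsupport x` varies with `x`. Enlarging it only adds zero terms, so near each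
  -- point the sum runs over one fixed finite set and is a plot.
  have hfin : ∀ x, ∀ s : Finset _, ρ.finsupport x ⊆ s →
      ∑ i ∈ s, ρ i x • p i x = ∑ i ∈ ρ.finsupport x, ρ i x • p i x := by
    intro x s hs
    refine (Finset.sum_subset hs fun i _ hi => ?_).symm
    have : ρ i x = 0 := by simpa using hi
    rw [this, zero_smul]
  refine ⟨fun x => ∑ i ∈ ρ.finsupport x, ρ i x • p i x, ?_, fun x => ?_⟩
  · refine isPlot_of_eventuallyEq fun x => ⟨fun y => ∑ i ∈ ρ.fintsupport x, ρ i y • p i y, ?_, ?_⟩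
    · exact isPlot_sum _ fun i => isPlot_smul (ρ i).contMDiff.contDiff.isPlot (hp i)
    · filter_upwards [ρ.eventually_finsupport_subset x] with y hy
      exact hfin y _ hy
  · rw [map_sum]
    -- Subordination makes every `p i` with nonzero weight a lift at `x`; weights of total 1
    -- preserve this because `f` is linear.
    calc ∑ i ∈ ρ.finsupport x, f (ρ i x • p i x) = ∑ i ∈ ρ.finsupport x, ρ i x • q x := by
          refine Finset.sum_congr rfl fun i hi => ?_
          have hi' : ρ i x ≠ 0 := by simpa using hi
          have : x ∈ interior {y | f (p i y) = q y} := hρ i (subset_tsupport _ hi')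
          rw [map_smul, interior_subset this]
      _ = q x := by
          rw [← Finset.sum_smul, ρ.sum_finsupport x (Set.mem_univ x), one_smul]

/-! ### Free diffeological vector spaces on disjoint unions of Euclidean spaces -/

/-- The vector space with basis the disjoint union of the Euclidean spaces of dimension `m i`. -/
abbrev FreeEuclidean {ι : Type u} (m : ι → ℕ) : Type u :=
  (Σ i, EuclideanSpace ℝ (Fin (m i))) →₀ ℝ

namespace FreeEuclidean

variable {ι : Type u} (m : ι → ℕ)

/-- Finite sums of families `t ↦ c t • [x t]`, with `c` a smooth function and `x` a smooth map into
one of the Euclidean spaces. -/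
noncomputable def sums (n : ℕ) : AddSubmonoid (EuclideanSpace ℝ (Fin n) → FreeEuclidean m) :=
  AddSubmonoid.closure {r | ∃ (i : ι) (c : EuclideanSpace ℝ (Fin n) → ℝ)
    (x : EuclideanSpace ℝ (Fin n) → EuclideanSpace ℝ (Fin (m i))),
    ContDiff ℝ ∞ c ∧ ContDiff ℝ ∞ x ∧ r = fun t => Finsupp.single ⟨i, x t⟩ (c t)}

variable {m}

theorem single_mem_sums {n : ℕ} {i : ι} {c : EuclideanSpace ℝ (Fin n) → ℝ}
    {x : EuclideanSpace ℝ (Fin n) → EuclideanSpace ℝ (Fin (m i))}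
    (hc : ContDiff ℝ ∞ c) (hx : ContDiff ℝ ∞ x) :
    (fun t => Finsupp.single ⟨i, x t⟩ (c t)) ∈ sums m n :=
  AddSubmonoid.subset_closure ⟨i, c, x, hc, hx, rfl⟩

theorem const_mem_sums {n : ℕ} (v : FreeEuclidean m) : (fun _ => v) ∈ sums m n := by
  induction v using Finsupp.induction_linear with
  | zero => exact zero_mem _
  | add a b ha hb => exact add_mem ha hb
  | single a c => exact single_mem_sums contDiff_const contDiff_const

theorem comp_mem_sums {n k : ℕ} {r : EuclideanSpace ℝ (Fin n) → FreeEuclidean m}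
    (hr : r ∈ sums m n) {f : EuclideanSpace ℝ (Fin k) → EuclideanSpace ℝ (Fin n)}
    (hf : ContDiff ℝ ∞ f) : r ∘ f ∈ sums m k := by
  induction hr using AddSubmonoid.closure_induction with
  | mem r hr =>
    obtain ⟨i, c, x, hc, hx, rfl⟩ := hr
    exact single_mem_sums (hc.comp hf) (hx.comp hf)
  | zero => exact zero_mem _
  | add a b _ _ ha hb => exact add_mem ha hb

theorem smul_mem_sums {n : ℕ} {r : EuclideanSpace ℝ (Fin n) → FreeEuclidean m}
    (hr : r ∈ sums m n) {a : EuclideanSpace ℝ (Fin n) → ℝ} (ha : ContDiff ℝ ∞ a) :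
    (fun t => a t • r t) ∈ sums m n := by
  induction hr using AddSubmonoid.closure_induction with
  | mem r hr =>
    obtain ⟨i, c, x, hc, hx, rfl⟩ := hr
    simpa only [Finsupp.smul_single, smul_eq_mul] using single_mem_sums (ha.mul hc) hx
  | zero =>
    simp only [Pi.zero_apply, smul_zero]
    exact zero_mem _
  | add p q _ _ hp hq =>
    simp only [Pi.add_apply, smul_add]
    exact add_mem hp hq

variable (m) in
/-- The finest diffeology making `FreeEuclidean m` a diffeological vector space into which the
Euclidean spaces map smoothly. -/
instance instDiffeologicalSpace : DiffeologicalSpace (FreeEuclidean m) where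
  plots n := {q | ∀ x, ∃ r ∈ sums m n, ∀ᶠ y in 𝓝 x, r y = q y}
  constant_plots v _ := ⟨_, const_mem_sums v, by simp⟩
  plot_reparam {n k q f} hq hf x := by
    obtain ⟨r, hr, h⟩ := hq (f x)
    exact ⟨r ∘ f, comp_mem_sums hr hf, hf.continuous.continuousAt.eventually h⟩
  locality {n q} hq x := by
    obtain ⟨s, hs, hxs, h⟩ := hq x
    obtain ⟨φ, hφ, hφs, hφx⟩ := exists_contDiff_eventuallyEq_id hs hxs
    obtain ⟨r, hr, hrq⟩ := h hφs hφ x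
    refine ⟨r, hr, ?_⟩
    filter_upwards [hrq, hφx] with y h1 h2
    rw [h1, Function.comp_apply, h2]

instance instDiffeologicalVectorSpace : DiffeologicalVectorSpace (FreeEuclidean m) where
  dSmooth_add n p hp x := by
    obtain ⟨a, ha, ha'⟩ := hp.1 x
    obtain ⟨b, hb, hb'⟩ := hp.2 x
    refine ⟨_, add_mem ha hb, ?_⟩
    filter_upwards [ha', hb'] with y h1 h2
    rw [Pi.add_apply, h1, h2, Function.comp_apply]
  dSmooth_smul n p hp x := by
    obtain ⟨b, hb, hb'⟩ := hp.2 x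
    refine ⟨_, smul_mem_sums hb (IsPlot.contDiff hp.1), ?_⟩
    filter_upwards [hb'] with y h2
    rw [h2, Function.comp_apply]

theorem isPlot_single (i : ι) :
    IsPlot (fun t : EuclideanSpace ℝ (Fin (m i)) => (Finsupp.single ⟨i, t⟩ 1 : FreeEuclidean m)) :=
  fun _ => ⟨_, single_mem_sums (c := fun _ => 1) contDiff_const contDiff_id,
    .of_forall fun _ => rfl⟩

/-- The smooth linear map determined by a family of plots. -/
noncomputable def lift {W : Type v} [AddCommGroup W] [Module ℝ W] [DiffeologicalSpace W]
    [DiffeologicalVectorSpace W] (p : ∀ i, EuclideanSpace ℝ (Fin (m i)) → W)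
    (hp : ∀ i, IsPlot (p i)) : SmoothLinearMap (FreeEuclidean m) W where
  toLinearMap := Finsupp.linearCombination ℝ fun a => p a.1 a.2
  smooth n q hq := by
    refine isPlot_of_eventuallyEq fun x => ?_
    obtain ⟨r, hr, h⟩ := hq x
    refine ⟨fun t => Finsupp.linearCombination ℝ (fun a => p a.1 a.2) (r t), ?_, ?_⟩
    · clear h
      induction hr using AddSubmonoid.closure_induction with
      | mem r hr =>
        obtain ⟨i, c, x, hc, hx, rfl⟩ := hr
        simp only [Finsupp.linearCombination_single]
        exact isPlot_smul hc.isPlot (isPlot_reparam (hp i) hx)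
      | zero => simpa using isPlot_const
      | add a b _ _ ha hb => simpa only [Pi.add_apply, map_add] using isPlot_add ha hb
    · filter_upwards [h] with y hy
      rw [hy, Function.comp_apply]

@[simp]
theorem lift_single {W : Type v} [AddCommGroup W] [Module ℝ W] [DiffeologicalSpace W]
    [DiffeologicalVectorSpace W] (p : ∀ i, EuclideanSpace ℝ (Fin (m i)) → W)
    (hp : ∀ i, IsPlot (p i)) (a : Σ i, EuclideanSpace ℝ (Fin (m i))) (c : ℝ) :
    (lift p hp).1 (Finsupp.single a c) = c • p a.1 a.2 :=
  Finsupp.linearCombination_single ..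

/-- A map out of the free space is determined by one plot per index, so it suffices to lift the
plots `g ∘ single`. The lifts must be defined on the whole Euclidean space, hence the need for
gluing. -/
theorem isProjectiveDVS : IsProjectiveDVS (FreeEuclidean m) := by
  intro W₁ _ _ _ _ W₂ _ _ _ _ f hf g
  choose p hp hpg using fun i => hf.exists_isPlot_lift (g.2 _ _ (isPlot_single (m := m) i))
  refine ⟨lift p hp, fun v => ?_⟩
  suffices g.1 = f ∘ₗ (lift p hp).1 from LinearMap.congr_fun this v
  refine Finsupp.lhom_ext fun a c => ?_
  rw [LinearMap.comp_apply, lift_single, map_smul, hpg, Function.comp_apply, ← map_smul,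
    Finsupp.smul_single, smul_eq_mul, mul_one]

end FreeEuclidean

/-! ### Enough projectives and existence of resolutions -/

/-- The free diffeological vector space on the disjoint union of the domains of all plots
of `V`. -/
abbrev FreeOnPlots (V : Type u) [DiffeologicalSpace V] : Type u :=
  FreeEuclidean fun i : Σ n : ℕ, {p : EuclideanSpace ℝ (Fin n) → V // IsPlot p} => i.1

section EnoughProjectives

variable (V : Type u) [AddCommGroup V] [Module ℝ V] [DiffeologicalSpace V]
  [DiffeologicalVectorSpace V]

/-- The tautological map `FreeOnPlots V → V`, evaluating every plot. -/
noncomputable def FreeOnPlots.eval : SmoothLinearMap (FreeOnPlots V) V :=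
  FreeEuclidean.lift (fun i => i.2.1) (fun i => i.2.2)

/-- Each plot of `V` is itself an index, and the basis vectors over its domain form a global lift of
it. Constant plots on the zero-dimensional space give surjectivity. -/
theorem FreeOnPlots.isSubduction_eval : IsSubduction (FreeOnPlots.eval V).1 := by
  have key : ∀ (n : ℕ) (q : EuclideanSpace ℝ (Fin n) → V), IsPlot q →
      ∃ p : EuclideanSpace ℝ (Fin n) → FreeOnPlots V, IsPlot p ∧
        ∀ y, (FreeOnPlots.eval V).1 (p y) = q y := by
    intro n q hq
    let i : Σ n : ℕ, {p : EuclideanSpace ℝ (Fin n) → V // IsPlot p} := ⟨n, q, hq⟩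
    refine ⟨_, FreeEuclidean.isPlot_single (m := fun i => i.1) i, fun y => ?_⟩
    rw [FreeOnPlots.eval, FreeEuclidean.lift_single, one_smul]
  refine ⟨fun v => ?_, (FreeOnPlots.eval V).2, fun n q hq x => ?_⟩
  · obtain ⟨p, -, h⟩ := key 0 (fun _ => v) isPlot_const
    exact ⟨p 0, h 0⟩
  · obtain ⟨p, hp, h⟩ := key n q hq
    exact ⟨p, hp, .of_forall h⟩

end EnoughProjectives

/-! ### Exactness and descent along subductions -/

theorem dSmooth_subtype_val {X : Type*} [DiffeologicalSpace X] {s : X → Prop} :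
    DSmooth (Subtype.val : Subtype s → X) :=
  fun _ _ hp => hp

section Exactness

variable {A : Type u} [AddCommGroup A] [Module ℝ A] [DiffeologicalSpace A]
  {V : Type v} [AddCommGroup V] [Module ℝ V] [DiffeologicalSpace V]
  {B : Type w} [AddCommGroup B] [Module ℝ B] [DiffeologicalSpace B]

theorem IsDiffeologicalExactAt.ker_eq_range {f : A →ₗ[ℝ] V} {g : V →ₗ[ℝ] B}
    (h : IsDiffeologicalExactAt f g) : LinearMap.ker g = LinearMap.range f := by
  have := h.exact.linearMap_ker_eq
  rwa [LinearMap.ker_rangeRestrict, Submodule.range_liftQ] at this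

/-- The induction condition on `A / ker f → V` comes for free: a plot of `V` with values in `range
f` lifts locally to `A` because `f` is a subduction onto its range. A resolution thus only needs
each arrow to be a subduction onto the next kernel. -/
theorem IsDiffeologicalExactAt.of_isSubduction {f : A →ₗ[ℝ] V} {g : V →ₗ[ℝ] B}
    (hfg : LinearMap.ker g = LinearMap.range f)
    (hf : IsSubduction f.rangeRestrict) (hg : IsSubduction g.rangeRestrict) :
    IsDiffeologicalExactAt f g := by
  have hinj : Function.Injective ((LinearMap.ker f).liftQ f le_rfl) :=
    LinearMap.ker_eq_bot.mp (Submodule.ker_liftQ_eq_bot _ _ _ le_rfl)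
  have hfs : DSmooth f := dSmooth_subtype_val.comp hf.2.1
  refine ⟨hinj, ?_, hg.1, ⟨hinj, fun n p => ⟨fun hp => ?_, fun hp x => ?_⟩⟩, hg⟩
  · rw [LinearMap.exact_iff, LinearMap.ker_rangeRestrict, Submodule.range_liftQ, hfg]
  · refine isPlot_of_eventuallyEq fun x => ?_
    obtain ⟨r, hr, h⟩ := hp x
    refine ⟨f ∘ r, hfs n r hr, ?_⟩
    filter_upwards [h] with y hy
    rw [Function.comp_apply, Function.comp_apply, ← hy, Submodule.mkQ_apply,
      Submodule.liftQ_apply]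
  · have hmem : ∀ t, (LinearMap.ker f).liftQ f le_rfl (p t) ∈ LinearMap.range f := fun t => by
      rw [← Submodule.range_liftQ (LinearMap.ker f) f le_rfl]
      exact LinearMap.mem_range_self _ _
    obtain ⟨r, hr, h⟩ := hf.2.2 n (fun t => ⟨_, hmem t⟩) hp x
    refine ⟨r, hr, ?_⟩
    filter_upwards [h] with y hy
    exact hinj (congrArg Subtype.val hy)

/-- A smooth linear map out of the source of a linear subduction that vanishes on its kernel
descends to the target. -/
theorem IsSubduction.exists_factor {f : A →ₗ[ℝ] V} (hf : IsSubduction f) (g : SmoothLinearMap A B)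
    (hg : LinearMap.ker f ≤ LinearMap.ker g.1) :
    ∃ k : SmoothLinearMap V B, ∀ a, k.1 (f a) = g.1 a := by
  let e := f.quotKerEquivOfSurjective hf.1
  have hk : ∀ a, (LinearMap.ker f).liftQ g.1 hg (e.symm (f a)) = g.1 a := fun a => by
    have : e.symm (f a) = (LinearMap.ker f).mkQ a := by
      rw [LinearEquiv.symm_apply_eq]; rfl
    rw [this, Submodule.mkQ_apply, Submodule.liftQ_apply]
  refine ⟨⟨(LinearMap.ker f).liftQ g.1 hg ∘ₗ e.symm.toLinearMap, fun n q hq => ?_⟩, hk⟩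
  -- On local lifts along `f` the descended map is just `g`, so smoothness is inherited.
  refine isPlot_of_eventuallyEq fun x => ?_
  obtain ⟨p, hp, h⟩ := hf.2.2 n q hq x
  refine ⟨_, g.2 n p hp, ?_⟩
  filter_upwards [h] with y hy
  exact (hk (p y)).symm.trans (by rw [hy]; rfl)

end Exactness

/-! ### Construction of free resolutions by covering kernels -/

/-- A smooth linear map out of a projective diffeological vector space that is a subduction onto its
range: one arrow of a projective resolution. -/
structure ResolutionArrow : Type (u + 1) where
  source : Type u
  target : Type u
  [sourceAddCommGroup : AddCommGroup source]
  [sourceModule : Module ℝ source]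
  [sourceDiffeologicalSpace : DiffeologicalSpace source]
  [sourceDVS : DiffeologicalVectorSpace source]
  [targetAddCommGroup : AddCommGroup target]
  [targetModule : Module ℝ target]
  [targetDiffeologicalSpace : DiffeologicalSpace target]
  [targetDVS : DiffeologicalVectorSpace target]
  map : SmoothLinearMap source target
  projective : IsProjectiveDVS source
  isSubduction : IsSubduction map.1.rangeRestrict

namespace ResolutionArrow

attribute [instance] sourceAddCommGroup sourceModule sourceDiffeologicalSpace sourceDVS
  targetAddCommGroup targetModule targetDiffeologicalSpace targetDVS

section OfSubmodule

variable {V : Type u} [AddCommGroup V] [Module ℝ V] [DiffeologicalSpace V]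
  [DiffeologicalVectorSpace V] (S : Submodule ℝ V)

/-- A free diffeological vector space mapping onto the subspace `S`. -/
noncomputable def cover : SmoothLinearMap (FreeOnPlots S) V where
  toLinearMap := S.subtype ∘ₗ (FreeOnPlots.eval S).1
  smooth := dSmooth_subtype_val.comp (FreeOnPlots.eval S).2

theorem range_cover : LinearMap.range (cover S).1 = S := by
  rw [cover, LinearMap.range_comp,
    LinearMap.range_eq_top.mpr (FreeOnPlots.isSubduction_eval S).1, Submodule.map_top,
    Submodule.range_subtype]

theorem isSubduction_cover : IsSubduction (cover S).1.rangeRestrict := by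
  refine ⟨LinearMap.surjective_rangeRestrict _, (cover S).2, fun n q hq x => ?_⟩
  have hq' : ∀ t, (q t : V) ∈ S := fun t => (range_cover S).le (q t).2
  obtain ⟨p, hp, h⟩ := (FreeOnPlots.isSubduction_eval S).2.2 n (fun t => ⟨q t, hq' t⟩) hq x
  refine ⟨p, hp, ?_⟩
  filter_upwards [h] with y hy
  exact Subtype.ext (congrArg (Subtype.val : S → V) hy)

/-- The arrow `FreeOnPlots S → V` with range `S`. -/
noncomputable abbrev ofSubmodule : ResolutionArrow.{u} where
  source := FreeOnPlots S
  target := V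
  map := cover S
  projective := FreeEuclidean.isProjectiveDVS
  isSubduction := isSubduction_cover S

end OfSubmodule

/-- The arrow covering the kernel of the given one. -/
noncomputable abbrev next (s : ResolutionArrow.{u}) : ResolutionArrow.{u} :=
  ofSubmodule (LinearMap.ker s.map.1)

theorem exactAt_next (s : ResolutionArrow.{u}) :
    IsDiffeologicalExactAt s.next.map.1 s.map.1 :=
  .of_isSubduction (range_cover _).symm s.next.isSubduction s.isSubduction

/-- The arrows of the resolution starting with `FreeOnPlots V → V`. -/
noncomputable def iterate (V : Type u) [AddCommGroup V] [Module ℝ V] [DiffeologicalSpace V]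
    [DiffeologicalVectorSpace V] : ℕ → ResolutionArrow.{u}
  | 0 => ofSubmodule (⊤ : Submodule ℝ V)
  | n + 1 => (iterate V n).next

end ResolutionArrow

namespace DiffeologicalProjectiveResolution

/-- Every diffeological vector space has a projective resolution by free ones. -/
noncomputable def free (V : Type u) [AddCommGroup V] [Module ℝ V] [DiffeologicalSpace V]
    [DiffeologicalVectorSpace V] : DiffeologicalProjectiveResolution V where
  X n := (ResolutionArrow.iterate V n).source
  instAddCommGroup n := inferInstance
  instModule n := inferInstance
  instDiffeologicalSpace n := inferInstance
  instDVS n := inferInstance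
  projective n := (ResolutionArrow.iterate V n).projective
  -- By definition `next` has the previous source as its target and `iterate V (n + 1)` unfolds to
  -- it, so no transport between types arises.
  d n := (ResolutionArrow.iterate V n).next.map
  ε := ResolutionArrow.cover (⊤ : Submodule ℝ V)
  exact_augmentation := by
    refine ⟨LinearMap.range_eq_top.mp (ResolutionArrow.range_cover _),
      (ResolutionArrow.cover _).2, fun n q hq x => ?_⟩
    exact (FreeOnPlots.isSubduction_eval (⊤ : Submodule ℝ V)).2.2 n
      (fun t => ⟨q t, Submodule.mem_top⟩) hq x |>.imp fun p h => ⟨h.1, h.2.mono fun y hy =>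
        congrArg Subtype.val hy⟩
  exact_zero := (ResolutionArrow.iterate V 0).exactAt_next
  exact_succ n := (ResolutionArrow.iterate V (n + 1)).exactAt_next

/-! ### Vanishing of the first Ext -/

variable {V : Type u} [AddCommGroup V] [Module ℝ V] [DiffeologicalSpace V]
  [DiffeologicalVectorSpace V] (P : DiffeologicalProjectiveResolution V)
  (W : Type v) [AddCommGroup W] [Module ℝ W] [DiffeologicalSpace W] [DiffeologicalVectorSpace W]

/-- The cocycle condition `c ∘ d 1 = 0` is phrased with range and kernel so that it combines
directly with exactness. -/
theorem subsingleton_ext_one_iff : Subsingleton (P.Ext W 1) ↔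
    ∀ c : SmoothLinearMap (P.X 1) W, LinearMap.range (P.d 1).1 ≤ LinearMap.ker c.1 →
      ∃ b : SmoothLinearMap (P.X 0) W, ∀ x, b.1 ((P.d 0).1 x) = c.1 x := by
  rw [Submodule.Quotient.subsingleton_iff, Submodule.submoduleOf_eq_top]
  refine forall_congr' fun c => imp_congr ?_ ?_
  · rw [cocycles, LinearMap.mem_ker, LinearMap.range_le_ker_iff]
    exact SmoothLinearMap.toLinearMap_injective.eq_iff.symm
  · refine exists_congr fun b => ?_
    rw [← SmoothLinearMap.toLinearMap_injective.eq_iff, LinearMap.ext_iff]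
    rfl

theorem subsingleton_ext_one_of_isProjectiveDVS (hV : IsProjectiveDVS V) :
    Subsingleton (P.Ext W 1) := by
  rw [subsingleton_ext_one_iff]
  intro c hc
  -- Lifting the identity of `V` along the augmentation yields a smooth section.
  obtain ⟨s, hs⟩ := hV (P.X 0) V P.ε.1 P.exact_augmentation ⟨LinearMap.id, dSmooth_id⟩
  have hs : ∀ v, P.ε.1 (s.1 v) = v := fun v => (hs v).symm
  obtain ⟨k, hk⟩ := (P.exact_succ 0).isSubduction.exists_factor c <| by
    rw [LinearMap.ker_rangeRestrict, (P.exact_succ 0).ker_eq_range]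
    exact hc
  have hker := P.exact_zero.ker_eq_range
  let r : P.X 0 →ₗ[ℝ] P.X 0 := LinearMap.id - s.1 ∘ₗ P.ε.1
  have hr : ∀ x, r x ∈ LinearMap.range (P.d 0).1 := fun x => by
    rw [← hker, LinearMap.mem_ker]
    simp [r, hs]
  have hrs : DSmooth r :=
    ((⟨LinearMap.id, dSmooth_id⟩ : SmoothLinearMap (P.X 0) (P.X 0)) -
      ⟨s.1 ∘ₗ P.ε.1, s.2.comp P.ε.2⟩).2
  -- Since `ε ∘ d 0 = 0`, `r` fixes `d 0 x`, so `k ∘ r ∘ d 0` is the cocycle.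
  refine ⟨⟨k.1 ∘ₗ r.codRestrict _ hr, k.2.comp fun n p hp => hrs n p hp⟩, fun x => ?_⟩
  rw [← hk x, LinearMap.comp_apply]
  congr 1
  refine Subtype.ext ?_
  have : P.ε.1 ((P.d 0).1 x) = 0 := by
    rw [← LinearMap.mem_ker, hker]
    exact LinearMap.mem_range_self _ _
  simp [r, this]

end DiffeologicalProjectiveResolution

/-- If `Ext^1(V, ker f)`, computed from some projective resolution, vanishes, then smooth linear
maps out of `V` lift along the linear subduction `f`. -/
theorem isProjectiveDVS_of_subsingleton_ext_one {V : Type u} [AddCommGroup V] [Module ℝ V]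
    [DiffeologicalSpace V] [DiffeologicalVectorSpace V]
    (h : ∀ (W : Type u) [AddCommGroup W] [Module ℝ W] [DiffeologicalSpace W]
      [DiffeologicalVectorSpace W],
      ∃ P : DiffeologicalProjectiveResolution V, Subsingleton (P.Ext W 1)) :
    IsProjectiveDVS V := by
  intro W₁ _ _ _ _ W₂ _ _ _ _ f hf g
  obtain ⟨P, hP⟩ := h (LinearMap.ker f)
  rw [P.subsingleton_ext_one_iff] at hP
  obtain ⟨φ, hφ⟩ := P.projective 0 W₁ W₂ f hf ⟨g.1 ∘ₗ P.ε.1, g.2.comp P.ε.2⟩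
  have hφ : ∀ x, f (φ.1 x) = g.1 (P.ε.1 x) := fun x => (hφ x).symm
  have hker := P.exact_zero.ker_eq_range
  have hεd : ∀ x, P.ε.1 ((P.d 0).1 x) = 0 := fun x => by
    rw [← LinearMap.mem_ker, hker]
    exact LinearMap.mem_range_self _ _
  have hφd : ∀ x, (φ.1 ∘ₗ (P.d 0).1) x ∈ LinearMap.ker f := fun x => by
    rw [LinearMap.mem_ker, LinearMap.comp_apply, hφ, hεd, map_zero]
  obtain ⟨b, hb⟩ := hP ⟨(φ.1 ∘ₗ (P.d 0).1).codRestrict _ hφd, φ.2.comp (P.d 0).2⟩ <| by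
    rw [LinearMap.ker_codRestrict, ← (P.exact_succ 0).ker_eq_range]
    exact LinearMap.ker_le_ker_comp _ _
  -- Subtracting `b`, whose values lie in `ker f`, keeps `φ` a lift of `g ∘ ε` while making it
  -- vanish on `range (d 0) = ker ε`.
  let ψ : SmoothLinearMap (P.X 0) W₁ :=
    φ - ⟨(LinearMap.ker f).subtype ∘ₗ b.1, dSmooth_subtype_val.comp b.2⟩
  have hψ : ∀ x, ψ.1 x = φ.1 x - b.1 x := fun _ => rfl
  obtain ⟨k, hk⟩ := P.exact_augmentation.exists_factor ψ <| by
    rw [hker]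
    rintro _ ⟨x, rfl⟩
    rw [LinearMap.mem_ker, hψ, hb, sub_eq_zero]
    rfl
  refine ⟨k, fun v => ?_⟩
  obtain ⟨x, rfl⟩ := P.exact_augmentation.1 v
  rw [hk, hψ, map_sub, hφ, LinearMap.mem_ker.mp (b.1 x).2, sub_zero]

theorem corollary7p8 (V : Type u) [AddCommGroup V] [Module ℝ V] [DiffeologicalSpace V]
    [DiffeologicalVectorSpace V] :
    (IsProjectiveDVS V ↔
      ∀ (W : Type u) [AddCommGroup W] [Module ℝ W] [DiffeologicalSpace W]
        [DiffeologicalVectorSpace W] (P : DiffeologicalProjectiveResolution V),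
        Subsingleton (P.Ext W 1)) ∧
    (IsProjectiveDVS V ↔
      ∀ (W : Type u) [AddCommGroup W] [Module ℝ W] [DiffeologicalSpace W]
        [DiffeologicalVectorSpace W],
        ∃ P : DiffeologicalProjectiveResolution V, Subsingleton (P.Ext W 1)) := by
  refine ⟨⟨fun h W _ _ _ _ P => P.subsingleton_ext_one_of_isProjectiveDVS W h, fun h => ?_⟩,
    ⟨fun h W _ _ _ _ => ?_, isProjectiveDVS_of_subsingleton_ext_one⟩⟩
  -- The free resolution supplies an instance to which the universal hypothesis applies.
  · exact isProjectiveDVS_of_subsingleton_ext_one fun W _ _ _ _ =>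
      ⟨.free V, h W (.free V)⟩
  · exact ⟨.free V, DiffeologicalProjectiveResolution.subsingleton_ext_one_of_isProjectiveDVS _ W h⟩
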